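/- Let $m>1$ be an integer, let $q=2^m$, and let $\mathbb{F}_q$ be the field with $q$ elements. For a linear code $C\subseteq\mathbb{F}_q^n$ (a linear subspace), let $d(\cdot,\cdot)$ be the Hamming distance, and for $\mathbf v\in\mathbb{F}_q^n$ put $d(\mathbf v,C)=\min_{\mathbf x\in C}d(\mathbf v,\mathbf x)$, $\rho=\max_{\mathbf v\in\mathbb{F}_q^n}d(\mathbf v,C)$, and $B_{\mathbf v,t}=|\{\mathbf x\in C: d(\mathbf v,\mathbf x)=t\}|$ for $0\le t\le n$. The code $C$ is *completely regular* (CR) if $B_{\mathbf v,t}$ depends only on $t$ and $d(\mathbf v,C)$; it is *uniformly packed in the wide sense* (UPWS) if there are rational numbers $\beta_0,\dots,\beta_\rho$ such that $\sum_{i=0}^{\rho}\beta_iB_{\mathbf x,i}=1$ for every $\mathbf x\in\mathbb{F}_q^n$. An $[n,k,d]_q$ code is a $k$-dimensional subspace of $\mathbb{F}_q^n$ with minimum Hamming distance $d$, and it is *maximum distance separable* (MDS) if $d=n-k+1$. Theorem. (i) If $m$ is odd and $C$ is an MDS $[2^m+2,\,3,\,2^m]_{2^m}$ code, then $C$ is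 not UPWS, and $C$ is not CR. (ii) If $C$ is an MDS $[2^m+2,\,2^m-1,\,4]_{2^m}$ code, then $C$ is CR. -/

import Mathlib

/-! Block codes of length `n` over an alphabet `F` are sets `C : Set (Fin n → F)`;
linear codes are submodules `C : Submodule F (Fin n → F)`. Distances are Hamming distances. -/

namespace CodingTheory

section Block

variable {n : ℕ} {F : Type*} [DecidableEq F]

/-- The distance `d(v, C) = min {d(v, x) | x ∈ C}` (meaningful for nonempty `C`). -/
noncomputable def distToCode (C : Set (Fin n → F)) (v : Fin n → F) : ℕ :=
  sInf {t : ℕ | ∃ x ∈ C, hammingDist v x = t}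

/-- The number `B_{v,t} = |{x ∈ C | d(v, x) = t}|`. -/
noncomputable def distCount (C : Set (Fin n → F)) (v : Fin n → F) (t : ℕ) : ℕ :=
  Set.ncard {x : Fin n → F | x ∈ C ∧ hammingDist v x = t}

/-- The covering radius `ρ = max {d(v, C) | v ∈ F^n}` of a code over a finite alphabet. -/
noncomputable def coveringRadius [Fintype F] (C : Set (Fin n → F)) : ℕ :=
  Finset.univ.sup (fun v : Fin n → F => distToCode C v)

/-- Complete regularity: `B_{v,t}` depends only on `t` and on `d(v, C)`. -/
def IsCompletelyRegular (C : Set (Fin n → F)) : Prop :=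
  ∀ u v : Fin n → F, distToCode C u = distToCode C v →
    ∀ t : ℕ, t ≤ n → distCount C u t = distCount C v t

/-- Uniformly packed in the wide sense: there are rational packing coefficients
`β_0, …, β_ρ`, where `ρ` is the covering radius, with `∑_{i=0}^{ρ} β_i B_{x,i} = 1` for all `x`. -/
def IsUPWS [Fintype F] (C : Set (Fin n → F)) : Prop :=
  ∃ β : Fin (coveringRadius C + 1) → ℚ, ∀ x : Fin n → F,
    ∑ i : Fin (coveringRadius C + 1), β i * (distCount C x (i : ℕ) : ℚ) = 1

end Block

section Linear

variable {n : ℕ} {F : Type*} [Field F] [DecidableEq F]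

/-- `C` is an `[n, k, d]` code: a `k`-dimensional subspace of `F^n` whose minimum distance
(the least distance between two distinct codewords) is `d`. -/
def IsLinearCode (C : Submodule F (Fin n → F)) (k d : ℕ) : Prop :=
  Module.finrank F C = k ∧
    IsLeast {t : ℕ | ∃ x ∈ C, ∃ y ∈ C, x ≠ y ∧ hammingDist x y = t} d

/-- `C` is a maximum distance separable `[n, k, d]` code: it attains the Singleton bound
`d ≤ n - k + 1`, here written without subtraction. -/
def IsMDSCode (C : Submodule F (Fin n → F)) (k d : ℕ) : Prop :=
  IsLinearCode C k d ∧ d + k = n + 1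

end Linear

end CodingTheory

namespace CodingTheory

/-! ### Distances to a code; complete regularity implies uniform packing -/

section Distance

variable {n : ℕ} {F : Type*} [DecidableEq F]

/-! Write q = |F| and n = q + 2.

Part (i) combines a small covering radius with many dual weights. If some v were at distance at
least n - 3 from C, adjoining v to C and one further coordinate would give q + 3 vectors of a
four-dimensional space, any four independent. A vector R on no plane spanned by two of them then
defines a Steiner triple system: its blocks are the triples whose span contains R. Hence 3 would
divide the binomial coefficient of q + 3 over 2 (`three_dvd_choose_of_arc`), which fails for q = 2
mod 3, that is, for m odd. So the covering radius is at most n - 4. The dual code has every weight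
from 4 to n. Taking characters, packing coefficients define a functional on polynomials that kills
the Krawtchouk generating functions of these weights, hence (1 - X)^4 X^j for j ≤ n - 4. This is an
order-four recurrence for the coefficients; the top four vanish by the covering radius bound, so all
do, and their weighted sum cannot be 1. Failure of CR follows, since CR implies UPWS.

Part (ii): codewords of an MDS code are equidistributed on information sets, so the B_{v,t} with t <
d - 1 = 3 determine the rest. These few counts depend only on d(v, C): nearby codewords are unique,
and if d(v, C) ≥ 2 the codewords at distance 2 pair off the n coordinates. -/

theorem exists_hammingDist_eq_distToCode {C : Set (Fin n → F)} (hC : C.Nonempty) (v : Fin n → F) :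
    ∃ x ∈ C, hammingDist v x = distToCode C v := by
  obtain ⟨c, hc⟩ := hC
  exact Nat.sInf_mem (s := {t : ℕ | ∃ x ∈ C, hammingDist v x = t}) ⟨_, c, hc, rfl⟩

theorem distToCode_le_hammingDist {C : Set (Fin n → F)} (v : Fin n → F) {x : Fin n → F}
    (hx : x ∈ C) : distToCode C v ≤ hammingDist v x :=
  Nat.sInf_le ⟨x, hx, rfl⟩

theorem distToCode_le_coveringRadius [Fintype F] (C : Set (Fin n → F)) (v : Fin n → F) :
    distToCode C v ≤ coveringRadius C :=
  Finset.le_sup (f := fun v : Fin n → F => distToCode C v) (Finset.mem_univ v)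

open Classical in
theorem distCount_eq_card_filter [Fintype F] (C : Set (Fin n → F)) (v : Fin n → F) (t : ℕ) :
    distCount C v t = (Finset.univ.filter fun x => x ∈ C ∧ hammingDist v x = t).card := by
  rw [distCount, Set.ncard_eq_toFinset_card']
  congr 1
  ext x
  simp

theorem distCount_eq_zero_of_lt [Fintype F] {C : Set (Fin n → F)} {v : Fin n → F} {t : ℕ}
    (h : t < distToCode C v) : distCount C v t = 0 := by
  classical
  rw [distCount_eq_card_filter, Finset.card_eq_zero, Finset.filter_eq_empty_iff]
  rintro x - ⟨hx, rfl⟩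
  exact absurd (distToCode_le_hammingDist v hx) (by omega)

theorem distCount_distToCode_pos [Fintype F] {C : Set (Fin n → F)} (hC : C.Nonempty)
    (v : Fin n → F) : 0 < distCount C v (distToCode C v) := by
  classical
  rw [distCount_eq_card_filter, Finset.card_pos]
  obtain ⟨x, hx, h⟩ := exists_hammingDist_eq_distToCode hC v
  exact ⟨x, by simp [hx, h]⟩

theorem hammingDist_le_of_eqOn_compl {x y : Fin n → F} (S : Finset (Fin n))
    (h : ∀ i ∉ S, x i = y i) : hammingDist x y ≤ S.card := by
  refine Finset.card_le_card fun i hi => ?_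
  by_contra hS
  exact (Finset.mem_filter.1 hi).2 (h i hS)

theorem hammingDist_add_card_le_of_eqOn {x y : Fin n → F} (S : Finset (Fin n))
    (h : ∀ i ∈ S, x i = y i) : hammingDist x y + S.card ≤ n := by
  have h1 := hammingDist_le_of_eqOn_compl (x := x) (y := y) Sᶜ (fun i hi => h i (by simpa using hi))
  have h2 := S.card_add_card_compl
  rw [Fintype.card_fin] at h2
  omega

/-- A completely regular code is uniformly packed in the wide sense: the packing coefficients
solve a triangular system. -/
theorem IsCompletelyRegular.isUPWS [Fintype F] {C : Set (Fin n → F)} (hC : C.Nonempty)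
    (h : IsCompletelyRegular C) : IsUPWS C := by
  classical
  set r := coveringRadius C with hr
  have hrn : r ≤ n := by
    refine Finset.sup_le fun v _ => ?_
    obtain ⟨x, -, hx⟩ := exists_hammingDist_eq_distToCode hC v
    rw [← hx]
    simpa using hammingDist_le_card_fintype (x := v) (y := x)
  -- Rows are indexed by distances to the code. A distance not known to occur gets a row of the
  -- identity, so `M` is invertible without showing that every value up to r is attained.
  let M : Matrix (Fin (r + 1)) (Fin (r + 1)) ℚ := fun l t =>
    if hl : ∃ v, distToCode C v = l then (distCount C hl.choose t : ℚ) else if l = t then 1 else 0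
  have hM : M.IsUpperTriangular := by
    intro l t (htl : t < l)
    by_cases hl : ∃ v, distToCode C v = l
    · simp only [M, dif_pos hl]
      rw [distCount_eq_zero_of_lt, Nat.cast_zero]
      rw [hl.choose_spec]
      exact htl
    · simp only [M, dif_neg hl, if_neg htl.ne']
  have hdet : M.det ≠ 0 := by
    rw [Matrix.det_of_isUpperTriangular hM, Finset.prod_ne_zero_iff]
    intro l _
    by_cases hl : ∃ v, distToCode C v = l
    · simp only [M, dif_pos hl]
      have := distCount_distToCode_pos hC hl.choose
      rw [hl.choose_spec] at this
      exact_mod_cast this.ne'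
    · simp only [M, dif_neg hl, if_true, ne_eq, one_ne_zero, not_false_eq_true]
  refine ⟨M⁻¹.mulVec 1, fun v => ?_⟩
  have key : M.mulVec (M⁻¹.mulVec 1) = 1 := by
    rw [Matrix.mulVec_mulVec, Matrix.mul_nonsing_inv _ (isUnit_iff_ne_zero.2 hdet),
      Matrix.one_mulVec]
  have hlt : distToCode C v < r + 1 := Nat.lt_succ_of_le (distToCode_le_coveringRadius C v)
  have hl : ∃ u, distToCode C u = ((⟨distToCode C v, hlt⟩ : Fin (r + 1)) : ℕ) := ⟨v, rfl⟩
  have := congrFun key ⟨distToCode C v, hlt⟩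
  rw [Pi.one_apply] at this
  rw [← this, Matrix.mulVec, dotProduct]
  refine Finset.sum_congr rfl fun t _ => ?_
  simp only [M, dif_pos hl]
  rw [mul_comm, h v hl.choose hl.choose_spec.symm t (by have := t.2; omega)]

end Distance

/-! ### Arcs, covering by spans, and Steiner triple systems -/

section Covering

/-- A set of `q + 1 + s` points of a space of dimension `s + 2`, any `s + 2` of which are
independent: every vector lies in the span of any `s` of the points and one further point. -/
theorem exists_support_subset_insert {F V ι : Type*} [Field F] [Fintype F] [AddCommGroup V]
    [Module F V] [Fintype V] [Fintype ι] [DecidableEq ι] {s : ℕ} (H : (ι → F) →ₗ[F] V)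
    (hV : Fintype.card V = Fintype.card F ^ (s + 2)) (hι : Fintype.card ι = Fintype.card F + 1 + s)
    (hH : ∀ (w : ι → F) (T : Finset ι), T.card ≤ s + 2 → (∀ i ∉ T, w i = 0) → H w = 0 → w = 0)
    (S : Finset ι) (hS : S.card = s) (R : V) :
    ∃ k ∉ S, ∃ w : ι → F, (∀ i ∉ insert k S, w i = 0) ∧ H w = R := by
  classical
  -- Words supported on S and at most one further coordinate, each listed once; `none` means no
  -- further coordinate. There are q^s (1 + (q + 1)(q - 1)) = q^(s + 2) of them, exactly the size of
  -- V, so injectivity of H on them suffices.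
  let c : Option ({k // k ∉ S} × Fˣ) → ι → F := fun o =>
    o.elim 0 fun p => Pi.single (p.1 : ι) (p.2 : F)
  let e : (S → F) × Option ({k // k ∉ S} × Fˣ) → ι → F := fun p i =>
    if h : i ∈ S then p.1 ⟨i, h⟩ else c p.2 i
  have hc : ∀ o, ∃ k ∉ S, ∀ i, i ≠ k → c o i = 0 := by
    rintro (_ | ⟨k, a⟩)
    · obtain ⟨k, hk⟩ : ∃ k, k ∉ S := by
        by_contra! hall
        rw [Finset.eq_univ_iff_forall.2 hall, Finset.card_univ] at hS
        omega
      exact ⟨k, hk, fun i _ => rfl⟩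
    · exact ⟨k, k.2, fun i hi => Pi.single_eq_of_ne hi _⟩
  have he : ∀ p, ∃ k ∉ S, ∀ i ∉ insert k S, e p i = 0 := by
    intro p
    obtain ⟨k, hk, h⟩ := hc p.2
    refine ⟨k, hk, fun i hi => ?_⟩
    rw [Finset.mem_insert, not_or] at hi
    simp only [e, dif_neg hi.2]
    exact h i hi.1
  have hinj : Function.Injective e := by
    rintro ⟨g, o⟩ ⟨g', o'⟩ h
    have hg : g = g' := by
      ext ⟨i, hi⟩
      simpa [e, hi] using congrFun h i
    have ho : ∀ i ∉ S, c o i = c o' i := fun i hi => by simpa [e, hi] using congrFun h i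
    rw [hg, Prod.mk.injEq, eq_self, true_and]
    rcases o with _ | ⟨k, a⟩ <;> rcases o' with _ | ⟨k', a'⟩
    · rfl
    · have := ho k' k'.2
      simp [c] at this
      exact absurd this.symm a'.ne_zero
    · have := ho k k.2
      simp [c] at this
    · have := ho k k.2
      simp only [c, Option.elim_some, Pi.single_eq_same] at this
      by_cases hk : k = k'
      · subst hk
        simp only [Pi.single_eq_same] at this
        rw [Units.ext this]
      · rw [Pi.single_eq_of_ne (fun hh => hk (Subtype.ext hh))] at this
        exact absurd this a.ne_zero
  have hHinj : Function.Injective (fun p => H (e p)) := by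
    intro p p' h
    apply hinj
    obtain ⟨k, hk, hp⟩ := he p
    obtain ⟨k', hk', hp'⟩ := he p'
    refine sub_eq_zero.1 (hH _ (insert k (insert k' S)) ?_ ?_ ?_)
    · have h1 := Finset.card_insert_le k (insert k' S)
      have h2 := Finset.card_insert_le k' S
      omega
    · intro i hi
      simp only [Finset.mem_insert, not_or] at hi
      rw [Pi.sub_apply, hp i (by simp [hi]), hp' i (by simp [hi]), sub_zero]
    · rw [map_sub]
      exact sub_eq_zero.2 h
  have hcard : Fintype.card ((S → F) × Option ({k // k ∉ S} × Fˣ)) = Fintype.card V := by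
    have h1 : Fintype.card {k // k ∉ S} = Fintype.card F + 1 := by
      rw [Fintype.card_subtype_compl, Fintype.card_coe, hι, hS]
      omega
    have h2 := Fintype.card_units F
    have h3 : 0 < Fintype.card F := Fintype.card_pos
    obtain ⟨q, hq⟩ : ∃ q, Fintype.card F = q + 1 := ⟨Fintype.card F - 1, by omega⟩
    rw [hV, Fintype.card_prod, Fintype.card_option, Fintype.card_prod, h1, Fintype.card_fun,
      Fintype.card_coe, hS, h2, hq]
    simp only [Nat.add_sub_cancel]
    ring
  obtain ⟨p, hp⟩ := ((Fintype.bijective_iff_injective_and_card _).2 ⟨hHinj, hcard⟩).2 R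
  obtain ⟨k, hk, h⟩ := he p
  exact ⟨k, hk, e p, h, hp⟩

/-- A set of `q + 3` points of a four-dimensional space, any four of which are independent,
carries a Steiner triple system (for `q > 6`), whence a divisibility condition. -/
theorem three_dvd_choose_of_arc {F V ι : Type*} [Field F] [Fintype F] [AddCommGroup V]
    [Module F V] [Fintype V] [Fintype ι] (H : (ι → F) →ₗ[F] V) (hq : 6 < Fintype.card F)
    (hV : Fintype.card V = Fintype.card F ^ 4) (hι : Fintype.card ι = Fintype.card F + 3)
    (hH : ∀ (w : ι → F) (T : Finset ι), T.card ≤ 4 → (∀ i ∉ T, w i = 0) → H w = 0 → w = 0) :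
    3 ∣ (Fintype.card F + 3).choose 2 := by
  classical
  let word : Finset ι → Finset (ι → F) := fun T =>
    Fintype.piFinset fun i => if i ∈ T then Finset.univ else {0}
  have hword : ∀ T w, w ∈ word T ↔ ∀ i ∉ T, w i = 0 := by
    intro T w
    simp only [word, Fintype.mem_piFinset]
    refine forall_congr' fun i => ?_
    by_cases hi : i ∈ T <;> simp [hi]
  have hwcard : ∀ T, (word T).card = Fintype.card F ^ T.card := by
    intro T
    rw [Fintype.card_piFinset]
    have : ∀ i, (if i ∈ T then (Finset.univ : Finset F) else {0}).card
        = if i ∈ T then Fintype.card F else 1 := by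
      intro i
      split_ifs <;> simp
    simp_rw [this]
    rw [Finset.prod_ite_mem, Finset.univ_inter, Finset.prod_const]
  -- The spans of pairs cover at most q^2 times the number of pairs; this is below q^4 because (q +
  -- 3)(q + 2) < 2 q^2 for q > 6.
  obtain ⟨R, hR⟩ : ∃ R : V, ∀ (w : ι → F) (T : Finset ι), T.card = 2 → (∀ i ∉ T, w i = 0) →
      H w ≠ R := by
    by_contra! hcon
    have hsub : (Finset.univ : Finset V) ⊆
        (Finset.powersetCard 2 (Finset.univ : Finset ι)).biUnion fun T => (word T).image H := by
      intro R _
      obtain ⟨w, T, hT, hw, hR⟩ := hcon R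
      rw [Finset.mem_biUnion]
      exact ⟨T, by simp [Finset.mem_powersetCard, hT],
        Finset.mem_image.2 ⟨w, (hword T w).2 hw, hR⟩⟩
    have h1 := (Finset.card_le_card hsub).trans (Finset.card_biUnion_le_card_mul _ _
      (Fintype.card F ^ 2) fun T hT => by
        refine Finset.card_image_le.trans ?_
        rw [hwcard, (Finset.mem_powersetCard.1 hT).2])
    rw [Finset.card_univ, hV, Finset.card_powersetCard, Finset.card_univ, hι] at h1
    have h2 : (Fintype.card F + 3).choose 2 * 2 = (Fintype.card F + 3) * (Fintype.card F + 2) := by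
      rw [Nat.choose_two_right, Nat.div_mul_cancel]
      · rfl
      · exact (Nat.even_mul_pred_self _).two_dvd
    have h3 : (Fintype.card F + 3).choose 2 < Fintype.card F ^ 2 := by nlinarith
    have h4 : 0 < Fintype.card F ^ 2 := by positivity
    nlinarith
  let 𝒯 : Finset (Finset ι) := (Finset.powersetCard 3 Finset.univ).filter fun T =>
    ∃ w : ι → F, (∀ i ∉ T, w i = 0) ∧ H w = R
  -- Every pair lies in a block: the covering lemma with s = 2 supplies the third point.
  have hunion : Finset.powersetCard 2 (Finset.univ : Finset ι)
      = 𝒯.biUnion fun T => Finset.powersetCard 2 T := by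
    ext S
    rw [Finset.mem_biUnion]
    constructor
    · intro hS
      have hS2 := (Finset.mem_powersetCard.1 hS).2
      obtain ⟨k, hk, w, hw, hwR⟩ := exists_support_subset_insert H hV (by omega) hH S hS2 R
      refine ⟨insert k S, ?_, ?_⟩
      · simp only [𝒯, Finset.mem_filter, Finset.mem_powersetCard, Finset.subset_univ, true_and]
        exact ⟨by rw [Finset.card_insert_of_notMem hk, hS2], w, hw, hwR⟩
      · exact Finset.mem_powersetCard.2 ⟨Finset.subset_insert _ _, hS2⟩
    · rintro ⟨T, -, hS⟩
      exact Finset.mem_powersetCard.2 ⟨Finset.subset_univ _, (Finset.mem_powersetCard.1 hS).2⟩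
  have hsupp : ∀ (T : Finset ι) (w : ι → F), T.card = 3 → (∀ i ∉ T, w i = 0) → H w = R →
      ∀ i ∈ T, w i ≠ 0 := by
    intro T w hT hw hwR i hi h0
    refine hR w (T.erase i) (by rw [Finset.card_erase_of_mem hi, hT]) (fun j hj => ?_) hwR
    by_cases hji : j = i
    · rw [hji, h0]
    · exact hw j fun hjT => hj (Finset.mem_erase.2 ⟨hji, hjT⟩)
  -- Blocks sharing a pair have at most four points together, so their expressions for R coincide;
  -- the choice of R makes each block the full support of its expression.
  have hdisj : ∀ T ∈ 𝒯, ∀ T' ∈ 𝒯, T ≠ T' →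
      Disjoint (Finset.powersetCard 2 T) (Finset.powersetCard 2 T') := by
    intro T hT T' hT' hne
    simp only [𝒯, Finset.mem_filter, Finset.mem_powersetCard] at hT hT'
    obtain ⟨⟨-, hT3⟩, w, hw, hwR⟩ := hT
    obtain ⟨⟨-, hT3'⟩, w', hw', hwR'⟩ := hT'
    rw [Finset.disjoint_left]
    intro S hS hS'
    obtain ⟨hST, hS2⟩ := Finset.mem_powersetCard.1 hS
    obtain ⟨hST', -⟩ := Finset.mem_powersetCard.1 hS'
    have hcard : (T ∪ T').card ≤ 4 := by
      have h1 := Finset.card_union_add_card_inter T T'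
      have h2 := Finset.card_le_card (Finset.subset_inter hST hST')
      omega
    have heq : w = w' := by
      refine sub_eq_zero.1 (hH _ _ hcard (fun i hi => ?_) (by rw [map_sub, hwR, hwR', sub_self]))
      rw [Finset.mem_union, not_or] at hi
      rw [Pi.sub_apply, hw i hi.1, hw' i hi.2, sub_zero]
    subst heq
    apply hne
    ext i
    refine ⟨fun hi => ?_, fun hi => ?_⟩
    · by_contra hi'
      exact hsupp T w hT3 hw hwR i hi (hw' i hi')
    · by_contra hi'
      exact hsupp T' w hT3' hw' hwR i hi (hw i hi')
  have hcount := congrArg Finset.card hunion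
  rw [Finset.card_biUnion hdisj, Finset.card_powersetCard, Finset.card_univ, hι] at hcount
  rw [hcount]
  refine Finset.dvd_sum fun T hT => ?_
  simp only [𝒯, Finset.mem_filter, Finset.mem_powersetCard] at hT
  rw [Finset.card_powersetCard, hT.1.2]
  rfl

end Covering
-- MDS codes: information sets, distance four, covering radius
section MDS

variable {n k d : ℕ} {F : Type*} [Field F] [DecidableEq F] {C : Submodule F (Fin n → F)}

theorem IsMDSCode.eq_of_hammingDist_lt (hC : IsMDSCode C k d) {x y : Fin n → F} (hx : x ∈ C)
    (hy : y ∈ C) (h : hammingDist x y < d) : x = y := by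
  by_contra hne
  exact absurd (hC.1.2.2 ⟨x, hx, y, hy, hne, rfl⟩) (by omega)

theorem IsMDSCode.eq_of_eqOn (hC : IsMDSCode C k d) {x y : Fin n → F} (hx : x ∈ C) (hy : y ∈ C)
    (S : Finset (Fin n)) (hS : k ≤ S.card) (h : ∀ i ∈ S, x i = y i) : x = y := by
  refine hC.eq_of_hammingDist_lt hx hy ?_
  have h1 := hammingDist_add_card_le_of_eqOn S h
  have h2 := hC.2
  omega

/-- Any `k` coordinates of an MDS code of dimension `k` form an information set. -/
theorem IsMDSCode.exists_eqOn (hC : IsMDSCode C k d) (hd : 0 < d) (S : Finset (Fin n))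
    (hS : S.card ≤ k) (v : Fin n → F) : ∃ x ∈ C, ∀ i ∈ S, x i = v i := by
  have h2 := hC.2
  obtain ⟨T, hST, hT⟩ := Finset.exists_superset_card_eq hS (by rw [Fintype.card_fin]; omega)
  let f : C →ₗ[F] (T → F) := (LinearMap.funLeft F F ((↑) : T → Fin n)).comp C.subtype
  have hinj : Function.Injective f := by
    intro x y h
    refine Subtype.ext (hC.eq_of_eqOn x.2 y.2 T hT.ge fun i hi => ?_)
    exact congrFun h ⟨i, hi⟩
  have hsurj : Function.Surjective f := by
    refine (LinearMap.injective_iff_surjective_of_finrank_eq_finrank ?_).1 hinj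
    rw [hC.1.1, Module.finrank_fintype_fun_eq_card, Fintype.card_coe, hT]
  obtain ⟨x, hx⟩ := hsurj fun i => v i
  exact ⟨x, x.2, fun i hi => congrFun hx ⟨i, hST hi⟩⟩

open Classical in
/-- The number of codewords agreeing with a word on at most `k` given coordinates does not
depend on the word. -/
theorem IsMDSCode.card_eqOn_eq [Fintype F] (hC : IsMDSCode C k d) (hd : 0 < d)
    (S : Finset (Fin n)) (hS : S.card ≤ k) (u v : Fin n → F) :
    (Finset.univ.filter fun x => x ∈ C ∧ ∀ i ∈ S, u i = x i).card =
      (Finset.univ.filter fun x => x ∈ C ∧ ∀ i ∈ S, v i = x i).card := by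
  -- Translation by a codeword interpolating v - u on S matches the two families.
  obtain ⟨c, hc, hcS⟩ := hC.exists_eqOn hd S hS (v - u)
  refine Finset.card_bij' (fun x _ => x + c) (fun x _ => x - c) ?_ ?_ ?_ ?_
  · simp only [Finset.mem_filter, Finset.mem_univ, true_and]
    rintro x ⟨hx, h⟩
    refine ⟨C.add_mem hx hc, fun i hi => ?_⟩
    rw [Pi.add_apply, hcS i hi, ← h i hi, Pi.sub_apply, add_sub_cancel]
  · simp only [Finset.mem_filter, Finset.mem_univ, true_and]
    rintro x ⟨hx, h⟩
    refine ⟨C.sub_mem hx hc, fun i hi => ?_⟩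
    rw [Pi.sub_apply, hcS i hi, ← h i hi, Pi.sub_apply, sub_sub_cancel]
  · intro x _
    exact add_sub_cancel_right x c
  · intro x _
    exact sub_add_cancel x c

/-- Double counting of the codewords and the `j`-sets on which they agree with `v`. -/
theorem sum_distCount_mul_choose [Fintype F] [DecidablePred (· ∈ C)] (v : Fin n → F) (j : ℕ) :
    ∑ t ∈ Finset.range (n + 1), distCount (C : Set (Fin n → F)) v t * (n - t).choose j =
      ∑ S ∈ Finset.powersetCard j (Finset.univ : Finset (Fin n)),
        (Finset.univ.filter fun x => x ∈ C ∧ ∀ i ∈ S, v i = x i).card := by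
  classical
  have hagree : ∀ x : Fin n → F,
      (Finset.univ.filter fun i => v i = x i).card = n - hammingDist v x := by
    intro x
    have := Finset.card_filter_add_card_filter_not (s := (Finset.univ : Finset (Fin n)))
      (fun i => v i = x i)
    rw [Finset.card_univ, Fintype.card_fin] at this
    rw [hammingDist]
    exact (Nat.sub_eq_of_eq_add this.symm).symm
  calc _ = ∑ t ∈ Finset.range (n + 1), ∑ x ∈ (Finset.univ.filter fun x => x ∈ C) with
        hammingDist v x = t, (n - hammingDist v x).choose j := by
        refine Finset.sum_congr rfl fun t _ => ?_
        rw [distCount_eq_card_filter, Finset.filter_filter, Finset.card_eq_sum_ones,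
          Finset.sum_mul]
        refine Finset.sum_congr (by ext; simp) fun x hx => ?_
        rw [one_mul, (Finset.mem_filter.1 hx).2.2]
    _ = ∑ x with x ∈ C, (n - hammingDist v x).choose j := by
        refine Finset.sum_fiberwise_of_maps_to (fun x _ => ?_) _
        rw [Finset.mem_range, Nat.lt_succ_iff]
        simpa using hammingDist_le_card_fintype (x := v) (y := x)
    _ = ∑ x with x ∈ C, ∑ S ∈ Finset.powersetCard j (Finset.univ : Finset (Fin n)),
          if ∀ i ∈ S, v i = x i then 1 else 0 := by
        refine Finset.sum_congr rfl fun x _ => ?_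
        rw [← hagree, ← Finset.card_powersetCard, ← Finset.card_filter]
        congr 1
        ext S
        simp only [Finset.mem_powersetCard, Finset.mem_filter, true_and, Finset.subset_iff,
          Finset.mem_univ]
        tauto
    _ = _ := by
        rw [Finset.sum_comm]
        refine Finset.sum_congr rfl fun S _ => ?_
        rw [← Finset.card_filter, Finset.filter_filter]

/-- In an MDS code the numbers `B_{v,t}` with `t < d` determine all of them. -/
theorem IsMDSCode.distCount_eq_of_forall_lt [Fintype F] (hC : IsMDSCode C k d) (hd : 0 < d)
    (u v : Fin n → F) (h : ∀ t < d - 1, distCount (C : Set (Fin n → F)) u t = distCount C v t)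
    (t : ℕ) (ht : t ≤ n) : distCount (C : Set (Fin n → F)) u t = distCount C v t := by
  classical
  induction t using Nat.strong_induction_on with
  | _ t ih =>
    by_cases htd : t < d - 1
    · exact h t htd
    have h2 := hC.2
    -- Agreement sets of size n - t ≤ k are used, the bound coming from t ≥ d - 1 = n - k. The
    -- resulting system is triangular: s = t has coefficient 1 and s > t has coefficient 0.
    have hsum : ∑ s ∈ Finset.range (n + 1),
        distCount (C : Set (Fin n → F)) u s * (n - s).choose (n - t) =
        ∑ s ∈ Finset.range (n + 1),
          distCount (C : Set (Fin n → F)) v s * (n - s).choose (n - t) := by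
      rw [sum_distCount_mul_choose, sum_distCount_mul_choose]
      refine Finset.sum_congr rfl fun S hS => ?_
      convert hC.card_eqOn_eq hd S ?_ u v
      rw [(Finset.mem_powersetCard.1 hS).2]
      omega
    have htn : t ∈ Finset.range (n + 1) := Finset.mem_range.2 (by omega)
    rw [← Finset.add_sum_erase _ _ htn, ← Finset.add_sum_erase _ _ htn, Nat.choose_self, mul_one,
      mul_one] at hsum
    refine Nat.add_right_cancel (hsum.trans ?_)
    congr 1
    refine Finset.sum_congr rfl fun s hs => ?_
    rw [Finset.mem_erase, Finset.mem_range] at hs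
    rcases lt_or_gt_of_ne hs.1 with hst | hst
    · rw [ih s hst (by omega)]
    · rw [Nat.choose_eq_zero_of_lt (by omega), mul_zero, mul_zero]

/-- For the dual hyperoval code, the codewords at distance two from a word at distance at least
two from the code have difference supports partitioning the coordinates. -/
theorem IsMDSCode.two_mul_distCount_two [Fintype F] (hC : IsMDSCode C k 4)
    (hn : n = Fintype.card F + 2) (v : Fin n → F) (hv : 2 ≤ distToCode (C : Set (Fin n → F)) v) :
    2 * distCount (C : Set (Fin n → F)) v 2 = n := by
  classical
  have h2 := hC.2
  have hqcard : Fintype.card ((Fin n → F) ⧸ C) = Fintype.card F ^ (1 + 2) := by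
    rw [Module.card_eq_pow_finrank (K := F)]
    have := Submodule.finrank_quotient_add_finrank C
    rw [hC.1.1, Module.finrank_fintype_fun_eq_card, Fintype.card_fin] at this
    congr 1
    omega
  have hH : ∀ (w : Fin n → F) (T : Finset (Fin n)), T.card ≤ 1 + 2 → (∀ i ∉ T, w i = 0) →
      C.mkQ w = 0 → w = 0 := by
    intro w T hT hw hw0
    rw [Submodule.mkQ_apply, Submodule.Quotient.mk_eq_zero] at hw0
    refine hC.eq_of_hammingDist_lt hw0 C.zero_mem ?_
    have := hammingDist_le_of_eqOn_compl (x := w) (y := 0) T hw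
    omega
  -- In the three-dimensional quotient by C, the covering lemma with s = 1 writes the class of v
  -- using any prescribed coordinate i and one other. Subtracting this word from v gives a codeword
  -- at distance exactly 2 that differs from v at i.
  have hunion : (Finset.univ : Finset (Fin n)) =
      (Finset.univ.filter fun x => x ∈ C ∧ hammingDist v x = 2).biUnion
        fun x => Finset.univ.filter fun i => v i ≠ x i := by
    symm
    rw [Finset.eq_univ_iff_forall]
    intro i
    obtain ⟨j, hj, w, hw, hwv⟩ := exists_support_subset_insert C.mkQ hqcard
      (by rw [Fintype.card_fin]; omega) hH {i} (Finset.card_singleton i) (C.mkQ v)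
    have hx : v - w ∈ C := by
      rw [← Submodule.Quotient.mk_eq_zero, ← Submodule.mkQ_apply, map_sub, hwv, sub_self]
    have hd2 := distToCode_le_hammingDist (C := (C : Set (Fin n → F))) v hx
    have hsub : (Finset.univ.filter fun l => v l ≠ (v - w) l) ⊆ insert j {i} := by
      intro l hl
      by_contra hl'
      exact (Finset.mem_filter.1 hl).2 (by rw [Pi.sub_apply, hw l hl', sub_zero])
    have hij : (insert j {i} : Finset (Fin n)).card = 2 := by
      rw [Finset.card_insert_of_notMem hj, Finset.card_singleton]
    have heq := Finset.eq_of_subset_of_card_le hsub (by rw [hij]; exact hv.trans hd2)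
    rw [Finset.mem_biUnion]
    refine ⟨v - w, ?_, by rw [heq]; simp⟩
    simp only [Finset.mem_filter, Finset.mem_univ, true_and]
    exact ⟨hx, by rw [hammingDist, heq, hij]⟩
  -- Overlapping supports would put two codewords at distance at most 3.
  have hdisj : ∀ x ∈ Finset.univ.filter (fun x => x ∈ C ∧ hammingDist v x = 2),
      ∀ y ∈ Finset.univ.filter (fun x => x ∈ C ∧ hammingDist v x = 2), x ≠ y →
      Disjoint (Finset.univ.filter fun i => v i ≠ x i)
        (Finset.univ.filter fun i => v i ≠ y i) := by
    simp only [Finset.mem_filter, Finset.mem_univ, true_and]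
    rintro x ⟨hx, hvx⟩ y ⟨hy, hvy⟩ hne
    rw [Finset.disjoint_iff_inter_eq_empty, ← Finset.card_eq_zero]
    by_contra hpos
    refine hne (hC.eq_of_hammingDist_lt hx hy ?_)
    have h3 := Finset.card_union_add_card_inter (Finset.univ.filter fun i => v i ≠ x i)
      (Finset.univ.filter fun i => v i ≠ y i)
    have h4 := hammingDist_le_of_eqOn_compl (x := x) (y := y)
      ((Finset.univ.filter fun i => v i ≠ x i) ∪ (Finset.univ.filter fun i => v i ≠ y i)) (by
        intro i hi
        simp only [Finset.mem_union, Finset.mem_filter, Finset.mem_univ, true_and, not_or,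
          not_not] at hi
        exact hi.1.symm.trans hi.2)
    unfold hammingDist at hvx hvy h4 ⊢
    omega
  have hcount := congrArg Finset.card hunion
  rw [Finset.card_univ, Fintype.card_fin, Finset.card_biUnion hdisj,
    Finset.sum_congr rfl (fun x hx => (Finset.mem_filter.1 hx).2.2), Finset.sum_const,
    smul_eq_mul] at hcount
  rw [distCount_eq_card_filter, mul_comm]
  exact hcount.symm

/-- A codeword within 2 of v and a nearest one, within 1, are at distance at most 3 < 4, so they
coincide. -/
theorem IsMDSCode.distCount_eq_one_of_le_one [Fintype F] (hC : IsMDSCode C k 4) (v : Fin n → F)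
    (hv : distToCode (C : Set (Fin n → F)) v ≤ 1) (t : ℕ) (ht : t ≤ 2) :
    distCount (C : Set (Fin n → F)) v t =
      if t = distToCode (C : Set (Fin n → F)) v then 1 else 0 := by
  classical
  obtain ⟨c, hc, hcv⟩ := exists_hammingDist_eq_distToCode (C := (C : Set (Fin n → F)))
    ⟨0, C.zero_mem⟩ v
  have huniq : ∀ x ∈ C, hammingDist v x ≤ 2 → x = c := by
    intro x hx hxv
    refine hC.eq_of_hammingDist_lt hx hc ?_
    have := hammingDist_triangle x v c
    rw [hammingDist_comm x v] at this
    omega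
  rw [distCount_eq_card_filter]
  split_ifs with htv
  · rw [Finset.card_eq_one]
    refine ⟨c, ?_⟩
    ext x
    simp only [Finset.mem_filter, Finset.mem_univ, true_and, Finset.mem_singleton]
    constructor
    · rintro ⟨hx, hxt⟩
      exact huniq x hx (by omega)
    · rintro rfl
      exact ⟨hc, by omega⟩
  · rw [Finset.card_eq_zero, Finset.filter_eq_empty_iff]
    rintro x - ⟨hx, hxt⟩
    obtain rfl := huniq x hx (by omega)
    omega

/-- An MDS code of length `q + 2` and minimum distance `4` is completely regular. -/
theorem IsMDSCode.isCompletelyRegular_of_distance_four [Fintype F] (hC : IsMDSCode C k 4)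
    (hn : n = Fintype.card F + 2) : IsCompletelyRegular (C : Set (Fin n → F)) := by
  intro u v huv
  refine hC.distCount_eq_of_forall_lt (by norm_num) u v fun t ht => ?_
  by_cases hu : distToCode (C : Set (Fin n → F)) u ≤ 1
  · rw [hC.distCount_eq_one_of_le_one u hu t (by omega),
      hC.distCount_eq_one_of_le_one v (by omega) t (by omega), huv]
  · by_cases ht2 : t = 2
    · subst ht2
      have h1 := hC.two_mul_distCount_two hn u (by omega)
      have h2 := hC.two_mul_distCount_two hn v (by omega)
      omega
    · rw [distCount_eq_zero_of_lt (by omega), distCount_eq_zero_of_lt (by omega)]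

/-- The covering radius bound for three-dimensional MDS codes of length `q + 2`. -/
theorem IsMDSCode.distToCode_add_four_le [Fintype F] (hC : IsMDSCode C 3 d)
    (hn : n = Fintype.card F + 2) (hq : 6 < Fintype.card F) (hmod : Fintype.card F % 3 = 2)
    (v : Fin n → F) : distToCode (C : Set (Fin n → F)) v + 4 ≤ n := by
  classical
  by_contra hcon
  have h2 := hC.2
  have hne : ∀ x ∈ C, ∀ S : Finset (Fin n), 4 ≤ S.card → ¬ ∀ i ∈ S, x i = v i := by
    intro x hx S hS h
    have h3 := hammingDist_add_card_le_of_eqOn (x := v) (y := x) S fun i hi => (h i hi).symm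
    have h4 := distToCode_le_hammingDist (C := (C : Set (Fin n → F))) v hx
    omega
  -- The arc: coordinate i gives the point (evaluation at i, v i) of Dual C × F, and `none` gives
  -- (0, 1).
  let A : (Option (Fin n) → F) →ₗ[F] Module.Dual F C :=
    { toFun := fun w => ∑ i : Fin n, w (some i) • (LinearMap.proj i).comp C.subtype
      map_add' := fun w w' => by simp [add_smul, Finset.sum_add_distrib]
      map_smul' := fun a w => by simp [mul_smul, Finset.smul_sum] }
  let B : (Option (Fin n) → F) →ₗ[F] F :=
    { toFun := fun w => w none + ∑ i : Fin n, w (some i) * v i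
      map_add' := fun w w' => by simp [add_mul, Finset.sum_add_distrib]; ring
      map_smul' := fun a w => by simp [mul_add, Finset.mul_sum, mul_assoc] }
  have hfin : Fintype (Module.Dual F C) :=
    @Fintype.ofFinite _ (Module.finite_of_finite F)
  have hdvd := three_dvd_choose_of_arc (A.prod B) hq (by
      rw [Module.card_eq_pow_finrank (K := F), Module.finrank_prod, Subspace.dual_finrank_eq,
        hC.1.1, Module.finrank_self]) (by
      rw [Fintype.card_option, Fintype.card_fin, hn]) (by
    intro w T hT hw h0
    replace h0 : A w = 0 ∧ B w = 0 := Prod.mk_eq_zero.1 h0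
    have hker : ∀ x ∈ C, ∑ i, w (some i) * (x i - v i) = w none := by
      intro x hx
      have hA : ∑ i, w (some i) * x i = 0 := by
        have := LinearMap.congr_fun h0.1 ⟨x, hx⟩
        simpa [A] using this
      have hB : w none + ∑ i, w (some i) * v i = 0 := h0.2
      simp_rw [mul_sub]
      rw [Finset.sum_sub_distrib, hA]
      linear_combination -hB
    have hTsome : ∀ i : Fin n, i ∉ T.eraseNone → w (some i) = 0 := fun i hi =>
      hw _ (by simpa [Finset.mem_eraseNone] using hi)
    -- A codeword agreeing with v on the other, at most three, coordinates of T kills the sum in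
    -- `hker`.
    have hnone : w none = 0 := by
      by_cases hTn : none ∈ T
      · have hc : T.eraseNone.card ≤ 3 := by
          rw [Finset.card_eraseNone_of_mem hTn]
          omega
        obtain ⟨x, hx, hxv⟩ := hC.exists_eqOn (by omega) _ hc v
        rw [← hker x hx]
        refine Finset.sum_eq_zero fun i _ => ?_
        by_cases hi : i ∈ T.eraseNone
        · rw [hxv i hi, sub_self, mul_zero]
        · rw [hTsome i hi, zero_mul]
      · exact hw _ hTn
    funext o
    rcases o with _ | l
    · exact hnone
    by_contra hl
    have hlT : l ∈ T.eraseNone := by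
      by_contra h
      exact hl (hTsome l h)
    have hc : (T.eraseNone.erase l).card ≤ 3 := by
      rw [Finset.card_erase_of_mem hlT]
      have := Finset.card_eraseNone_le (s := T)
      omega
    -- A codeword agreeing with v on three places that contain the support of w apart from l leaves
    -- only w_l (x_l - v_l) = 0. Agreement at l too would be a fourth, which the distance of v
    -- excludes.
    obtain ⟨S, hTS, hSl, hS⟩ := Finset.exists_subsuperset_card_eq
      (t := Finset.univ.erase l) (Finset.erase_subset_erase l (Finset.subset_univ T.eraseNone)) hc
      (by rw [Finset.card_erase_of_mem (Finset.mem_univ l), Finset.card_univ, Fintype.card_fin]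
          omega)
    have hlS : l ∉ S := fun h => (Finset.mem_erase.1 (hSl h)).1 rfl
    obtain ⟨x, hx, hxv⟩ := hC.exists_eqOn (by omega) S hS.le v
    have hsum := hker x hx
    rw [hnone, Finset.sum_eq_single l] at hsum
    · rcases mul_eq_zero.1 hsum with h | h
      · exact hl h
      · refine hne x hx (insert l S) (by rw [Finset.card_insert_of_notMem hlS, hS]) ?_
        rw [Finset.forall_mem_insert]
        exact ⟨sub_eq_zero.1 h, hxv⟩
    · intro i _ hi
      by_cases hiS : i ∈ S
      · rw [hxv i hiS, sub_self, mul_zero]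
      · rw [hTsome i fun h => hiS (hTS (Finset.mem_erase.2 ⟨hi, h⟩)), zero_mul]
    · exact fun h => absurd (Finset.mem_univ l) h)
  obtain ⟨a, ha⟩ : ∃ a, Fintype.card F = 3 * a + 2 := ⟨Fintype.card F / 3, by omega⟩
  have h3 : (Fintype.card F + 3).choose 2 * 2 = (Fintype.card F + 3) * (Fintype.card F + 2) := by
    rw [Nat.choose_two_right, Nat.div_mul_cancel]
    · rfl
    · exact (Nat.even_mul_pred_self _).two_dvd
  have h4 : 3 ∣ (3 * a + 2 + 3) * (3 * a + 2 + 2) := by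
    rw [← ha, ← h3]
    exact hdvd.mul_right 2
  have h5 : (3 * a + 2 + 3) * (3 * a + 2 + 2) = 3 * (3 * a * a + 9 * a + 6) + 2 := by ring
  omega

end MDS
open Polynomial

/-! ### Characters, Krawtchouk generating functions, and avoiding linear forms -/

section Fourier

/-- A functional on polynomials that annihilates the Krawtchouk generating functions
`(1 - X)^w (1 + (q - 1) X)^(n - w)` for `r ≤ w ≤ n` annihilates `(1 - X)^r X^j`. -/
theorem map_one_sub_X_pow_mul_X_pow_eq_zero {n r : ℕ} (Q : ℂ) (hQ : 1 + Q ≠ 0)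
    (Γ : ℂ[X] →ₗ[ℂ] ℂ)
    (h : ∀ w, r ≤ w → w ≤ n → Γ ((1 - X) ^ w * (1 + C Q * X) ^ (n - w)) = 0)
    (j w : ℕ) (hw : r ≤ w) (hj : w + j ≤ n) : Γ ((1 - X) ^ w * X ^ j) = 0 := by
  -- Total degree is lowered from n one step at a time by 1 + Q = (1 + Q X) + Q (1 - X). Afterwards
  -- X = 1 - (1 - X) trades the second factor for powers of X.
  have hB : ∀ e w j : ℕ, r ≤ w → w + j + e = n → Γ ((1 - X) ^ w * (1 + C Q * X) ^ j) = 0 := by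
    intro e
    induction e with
    | zero =>
      intro w j hw hj
      have := h w hw (by omega)
      rwa [show n - w = j by omega] at this
    | succ e ih =>
      intro w j hw hj
      have h1 := ih w (j + 1) hw (by omega)
      have h2 := ih (w + 1) j (by omega) (by omega)
      have key : (1 + Q) • ((1 - X) ^ w * (1 + C Q * X) ^ j : ℂ[X]) =
          (1 - X) ^ w * (1 + C Q * X) ^ (j + 1) +
            Q • ((1 - X) ^ (w + 1) * (1 + C Q * X) ^ j) := by
        simp only [smul_eq_C_mul, map_add, map_one]
        ring
      have h3 := congrArg Γ key
      rw [map_smul, map_add, map_smul, h1, h2, smul_zero, add_zero, smul_eq_mul] at h3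
      exact (mul_eq_zero.1 h3).resolve_left hQ
  induction j generalizing w with
  | zero =>
    have := hB (n - w) w 0 hw (by omega)
    simpa using this
  | succ j ih =>
    have h1 := ih w hw (by omega)
    have h2 := ih (w + 1) (by omega) (by omega)
    have key : ((1 - X) ^ w * X ^ (j + 1) : ℂ[X]) =
        (1 - X) ^ w * X ^ j - (1 - X) ^ (w + 1) * X ^ j := by ring
    rw [key, map_sub, h1, h2, sub_zero]

variable {n : ℕ} {F : Type*} [Field F] [Fintype F] [DecidableEq F]

/-- The MacWilliams transform of a character of `F^n`. -/
theorem sum_char_mul_X_pow_hammingNorm {ψ : AddChar F ℂ} (hψ : ψ.IsPrimitive) (u : Fin n → F) :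
    ∑ v : Fin n → F, C (ψ (∑ i, v i * u i)) * X ^ hammingNorm v =
      (1 - X : ℂ[X]) ^ hammingNorm u *
        (1 + C ((Fintype.card F : ℂ) - 1) * X) ^ (n - hammingNorm u) := by
  -- The sum over words factors over coordinates; this is one factor.
  have hfactor : ∀ b : F, ∑ a : F, C (ψ (a * b)) * (if a ≠ 0 then X else 1) =
      if b ≠ 0 then (1 - X : ℂ[X]) else 1 + C ((Fintype.card F : ℂ) - 1) * X := by
    intro b
    have h1 : ∑ a : F, C (ψ (a * b)) * (if a ≠ 0 then X else 1 : ℂ[X]) =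
        ∑ a : F, (C (ψ (a * b)) * X + if a = 0 then 1 - X else 0) := by
      refine Finset.sum_congr rfl fun a _ => ?_
      by_cases ha : a = 0
      · simp [ha]
      · simp [ha]
    rw [h1, Finset.sum_add_distrib, ← Finset.sum_mul, ← map_sum, AddChar.sum_mulShift b hψ,
      Finset.sum_ite_eq' Finset.univ, if_pos (Finset.mem_univ _)]
    by_cases hb : b = 0
    · simp [hb]
      ring
    · simp [hb]
  have hterm : ∀ v : Fin n → F, C (ψ (∑ i, v i * u i)) * X ^ hammingNorm v =
      ∏ i, (C (ψ (v i * u i)) * (if v i ≠ 0 then X else 1 : ℂ[X])) := by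
    intro v
    have hsum : ψ (∑ i, v i * u i) = ∏ i, ψ (v i * u i) :=
      map_prod ψ.toMonoidHom (fun i => Multiplicative.ofAdd (v i * u i)) Finset.univ
    rw [Finset.prod_mul_distrib, ← map_prod, ← hsum, Finset.prod_ite,
      Finset.prod_const, Finset.prod_const_one, mul_one]
    rfl
  have hprod := Finset.prod_univ_sum (fun _ : Fin n => (Finset.univ : Finset F))
    (fun i a => C (ψ (a * u i)) * (if a ≠ 0 then X else 1 : ℂ[X]))
  rw [Fintype.piFinset_univ] at hprod
  rw [Finset.sum_congr rfl fun v _ => hterm v, ← hprod, Finset.prod_congr rfl fun i _ =>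
    hfactor (u i), Finset.prod_ite, Finset.prod_const, Finset.prod_const]
  have hcard := Finset.card_filter_add_card_filter_not (s := (Finset.univ : Finset (Fin n)))
    (fun i => u i ≠ 0)
  rw [Finset.card_univ, Fintype.card_fin] at hcard
  have h1 : (Finset.univ.filter fun i => u i ≠ 0).card = hammingNorm u := rfl
  rw [h1] at hcard ⊢
  congr 2
  omega

/-- If the sum over the code of a function of the distance is constant, then the transform of
that function vanishes at every nonzero word of the dual code. -/
theorem map_krawtchouk_eq_zero (D : Submodule F (Fin n → F)) (β : ℕ → ℂ) (Γ : ℂ[X] →ₗ[ℂ] ℂ)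
    (hΓ : ∀ t, Γ (X ^ t) = β t) [DecidablePred (· ∈ D)]
    (h : ∀ v, ∑ x with x ∈ D, β (hammingDist v x) = 1)
    (u : Fin n → F) (hu : u ≠ 0) (hdual : ∀ x ∈ D, ∑ i, x i * u i = 0) :
    Γ ((1 - X) ^ hammingNorm u *
      (1 + C ((Fintype.card F : ℂ) - 1) * X) ^ (n - hammingNorm u)) = 0 := by
  have hψ := AddChar.FiniteField.primitiveChar_to_Complex_isPrimitive F
  set ψ := AddChar.FiniteField.primitiveChar_to_Complex F
  have hpoly := sum_char_mul_X_pow_hammingNorm hψ u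
  have hchar : ∑ v : Fin n → F, ψ (∑ i, v i * u i) = 0 := by
    have := congrArg (eval 1) hpoly
    rw [eval_finsetSum] at this
    have hpos : hammingNorm u ≠ 0 := by rwa [ne_eq, hammingNorm_eq_zero]
    simpa [hpos] using this
  have hshift : ∀ x ∈ D, ∑ v : Fin n → F, ψ (∑ i, v i * u i) * β (hammingDist v x) =
      ∑ v : Fin n → F, ψ (∑ i, v i * u i) * β (hammingNorm v) := by
    intro x hx
    refine Fintype.sum_equiv (Equiv.subRight x) _ _ fun v => ?_
    rw [Equiv.subRight_apply, hammingDist_comm, hammingDist_eq_hammingNorm, neg_add_eq_sub]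
    congr 2
    simp only [Pi.sub_apply, sub_mul, Finset.sum_sub_distrib, hdual x hx, sub_zero]
  -- Summed over x first, the inner sum is 1 and the character sum vanishes. By `hshift`, the same
  -- double sum is |D| times the transform at u.
  have hdouble : ∑ x with x ∈ D, ∑ v : Fin n → F, ψ (∑ i, v i * u i) * β (hammingDist v x)
      = 0 := by
    rw [Finset.sum_comm]
    simp_rw [← Finset.mul_sum, h, mul_one]
    exact hchar
  rw [Finset.sum_congr rfl fun x hx => hshift x (Finset.mem_filter.1 hx).2, Finset.sum_const,
    nsmul_eq_mul, mul_eq_zero] at hdouble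
  have hne : ((Finset.univ.filter fun x => x ∈ D).card : ℂ) ≠ 0 := by
    rw [Nat.cast_ne_zero, Finset.card_ne_zero]
    exact ⟨0, by simp⟩
  rw [← hpoly, map_sum, ← hdouble.resolve_left hne]
  refine Finset.sum_congr rfl fun v _ => ?_
  rw [← smul_eq_C_mul, map_smul, hΓ, smul_eq_mul]

/-- Coefficients on a nonempty set can be chosen nonzero and such that three linear forms with
nonzero coefficients do not vanish. -/
theorem exists_sum_mul_ne_zero {ι : Type*} [DecidableEq ι] (hq : 4 < Fintype.card F)
    (c : Fin 3 → ι → F) (T : Finset ι) (hT : T.Nonempty) (hc : ∀ l, ∀ i ∈ T, c l i ≠ 0) :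
    ∃ a : ι → F, (∀ i, a i ≠ 0 ↔ i ∈ T) ∧ ∀ l, ∑ i ∈ T, c l i * a i ≠ 0 := by
  induction hT using Finset.Nonempty.cons_induction with
  | singleton j =>
    refine ⟨Pi.single j 1, fun i => ?_, fun l => ?_⟩
    · by_cases h : i = j
      · simp [h]
      · simp [h]
    · simpa using hc l j (Finset.mem_singleton_self j)
  | cons j T hj hT ih =>
    obtain ⟨a, ha, hs⟩ := ih fun l i hi => hc l i (Finset.mem_cons_of_mem hi)
    let bad : Finset F :=
      -- The new coefficient must avoid zero and one root for each of the three forms: at most four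
      -- values, fewer than q.
      insert 0 (Finset.univ.image fun l => -(∑ i ∈ T, c l i * a i) / c l j)
    have hbad : bad.card < Fintype.card F := by
      have h1 := Finset.card_insert_le (0 : F)
        (Finset.univ.image fun l => -(∑ i ∈ T, c l i * a i) / c l j)
      have h2 : (Finset.univ.image fun l => -(∑ i ∈ T, c l i * a i) / c l j).card ≤ 3 :=
        Finset.card_image_le
      exact (h1.trans (Nat.add_le_add_right h2 1)).trans_lt hq
    obtain ⟨b, hb⟩ : ∃ b, b ∉ bad := by
      by_contra! hall
      rw [Finset.eq_univ_iff_forall.2 hall, Finset.card_univ] at hbad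
      exact lt_irrefl _ hbad
    simp only [bad, Finset.mem_insert, Finset.mem_image, Finset.mem_univ, true_and, not_or,
      not_exists] at hb
    refine ⟨Function.update a j b, fun i => ?_, fun l => ?_⟩
    · by_cases h : i = j
      · subst h
        simp [hb.1]
      · rw [Function.update_of_ne h, ha, Finset.mem_cons]
        simp [h]
    · have hsum : ∑ i ∈ T, c l i * Function.update a j b i = ∑ i ∈ T, c l i * a i := by
        refine Finset.sum_congr rfl fun i hi => ?_
        rw [Function.update_of_ne (ne_of_mem_of_not_mem hi hj)]
      rw [Finset.sum_cons, Function.update_self, hsum]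
      intro h0
      refine hb.2 l ?_
      rw [div_eq_iff (hc l j (Finset.mem_cons_self j T))]
      linear_combination -h0

end Fourier
-- Dual weights and the failure of uniform packing
section DualWeights

variable {n d : ℕ} {F : Type*} [Field F] [DecidableEq F] {D : Submodule F (Fin n → F)}

/-- The dual of a three-dimensional MDS code has words of every weight from `4` to `n`. -/
theorem IsMDSCode.exists_dual_hammingNorm_eq [Fintype F] (hD : IsMDSCode D 3 d) (hd : 0 < d)
    (hq : 4 < Fintype.card F) (w : ℕ) (hw : 4 ≤ w) (hwn : w ≤ n) :
    ∃ u : Fin n → F, hammingNorm u = w ∧ ∀ x ∈ D, ∑ i, x i * u i = 0 := by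
  let e : Fin 3 ↪ Fin n := Fin.castLEEmb (by omega)
  let S : Finset (Fin n) := Finset.univ.map e
  have hS : S.card = 3 := by simp [S]
  have heS : ∀ l, e l ∈ S := fun l => Finset.mem_map_of_mem e (Finset.mem_univ l)
  -- Rows of a systematic generator matrix on S. Off S no row has a zero, since together with its
  -- two zeros in S that would force the row to vanish.
  have hbasis : ∀ l, ∃ x ∈ D, ∀ i ∈ S, x i = (Pi.single (e l) 1 : Fin n → F) i := fun l =>
    hD.exists_eqOn hd S hS.le _
  choose c hcD hc using hbasis
  obtain ⟨T, hTS, hT⟩ := Finset.exists_subset_card_eq (s := Sᶜ) (n := w - 3) (by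
    rw [Finset.card_compl, hS, Fintype.card_fin]
    omega)
  have hST : Disjoint S T := Finset.disjoint_left.2 fun i hi hi' =>
    Finset.mem_compl.1 (hTS hi') hi
  obtain ⟨a, ha, hs⟩ := exists_sum_mul_ne_zero hq c T (Finset.card_pos.1 (by omega)) (by
    intro l i hi h0
    have hzero : c l = 0 := by
      refine hD.eq_of_eqOn (hcD l) D.zero_mem (insert i (S.erase (e l))) ?_ ?_
      · rw [Finset.card_insert_of_notMem, Finset.card_erase_of_mem (heS l), hS]
        exact fun h => Finset.mem_compl.1 (hTS hi) (Finset.mem_of_mem_erase h)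
      · rw [Finset.forall_mem_insert]
        refine ⟨h0, fun j hj => ?_⟩
        rw [hc l j (Finset.mem_of_mem_erase hj), Pi.single_eq_of_ne (Finset.ne_of_mem_erase hj),
          Pi.zero_apply]
    have h1 := hc l (e l) (heS l)
    rw [hzero, Pi.single_eq_same, Pi.zero_apply] at h1
    exact zero_ne_one h1)
  -- The entries on S are forced by orthogonality to the rows c l; the choice of a makes them
  -- nonzero, so the support is S ∪ T, of size 3 + (w - 3).
  let u : Fin n → F := a - ∑ l, Pi.single (e l) (∑ i ∈ T, c l i * a i)
  have hu : ∀ i, u i = a i - ∑ l, (Pi.single (e l) (∑ i ∈ T, c l i * a i) : Fin n → F) i := by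
    intro i
    simp only [u, Pi.sub_apply, Finset.sum_apply]
  have haT : ∀ i ∉ T, a i = 0 := fun i hi => by
    by_contra h
    exact hi ((ha i).1 h)
  have huS : ∀ l, u (e l) = -∑ i ∈ T, c l i * a i := by
    intro l
    rw [hu, haT _ (Finset.disjoint_left.1 hST (heS l)), Finset.sum_eq_single l, Pi.single_eq_same,
      zero_sub]
    · intro m _ hm
      exact Pi.single_eq_of_ne (fun h => hm (e.injective h).symm) _
    · exact fun h => absurd (Finset.mem_univ l) h
  have huT : ∀ i ∉ S, u i = a i := by
    intro i hi
    rw [hu, Finset.sum_eq_zero, sub_zero]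
    intro l _
    exact Pi.single_eq_of_ne (fun (h : i = e l) => hi (by rw [h]; exact heS l)) _
  refine ⟨u, ?_, ?_⟩
  · have hsupp : (Finset.univ.filter fun i => u i ≠ 0) = S ∪ T := by
      ext i
      rw [Finset.mem_filter, Finset.mem_union]
      by_cases hi : i ∈ S
      · obtain ⟨l, -, rfl⟩ := Finset.mem_map.1 hi
        simp only [Finset.mem_univ, true_and, hi, true_or, iff_true]
        rw [huS l]
        exact neg_ne_zero.2 (hs l)
      · simp [huT i hi, hi, ha i]
    rw [hammingNorm, hsupp, Finset.card_union_of_disjoint hST, hS, hT]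
    omega
  · intro x hx
    have hxc : x = ∑ l, x (e l) • c l := by
      refine hD.eq_of_eqOn hx (D.sum_mem fun l _ => D.smul_mem _ (hcD l)) S hS.ge fun i hi => ?_
      obtain ⟨m, -, rfl⟩ := Finset.mem_map.1 hi
      rw [Finset.sum_apply, Finset.sum_eq_single m]
      · rw [Pi.smul_apply, hc m _ hi, Pi.single_eq_same, smul_eq_mul, mul_one]
      · intro l _ hl
        rw [Pi.smul_apply, hc l _ hi, Pi.single_eq_of_ne (fun h => hl (e.injective h).symm),
          smul_zero]
      · exact fun h => absurd (Finset.mem_univ m) h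
    have hsplit : ∑ i, x i * u i = ∑ i ∈ S, x i * u i + ∑ i ∈ T, x i * u i := by
      rw [← Finset.sum_union hST]
      refine (Finset.sum_subset (Finset.subset_univ _) fun i _ hi => ?_).symm
      rw [Finset.mem_union, not_or] at hi
      rw [huT i hi.1, haT i hi.2, mul_zero]
    have hTsum : ∑ i ∈ T, x i * u i = ∑ l, x (e l) * ∑ i ∈ T, c l i * a i := by
      simp_rw [Finset.mul_sum]
      rw [Finset.sum_comm]
      refine Finset.sum_congr rfl fun i hi => ?_
      rw [huT i (Finset.disjoint_right.1 hST hi)]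
      conv_lhs => rw [hxc]
      rw [Finset.sum_apply, Finset.sum_mul]
      refine Finset.sum_congr rfl fun l _ => ?_
      rw [Pi.smul_apply, smul_eq_mul, mul_assoc]
    rw [hsplit, hTsum, Finset.sum_map, ← Finset.sum_add_distrib]
    refine Finset.sum_eq_zero fun l _ => ?_
    rw [huS l]
    ring

/-- The sum of a function of the distance to the codewords, grouped by distance. -/
theorem sum_range_mul_distCount [Fintype F] [DecidablePred (· ∈ D)] (β : ℕ → ℂ)
    (v : Fin n → F) :
    ∑ x with x ∈ D, β (hammingDist v x) =
      ∑ t ∈ Finset.range (n + 1), β t * distCount (D : Set (Fin n → F)) v t := by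
  classical
  rw [← Finset.sum_fiberwise_of_maps_to (s := Finset.univ.filter fun x => x ∈ D)
    (t := Finset.range (n + 1)) (g := fun x => hammingDist v x) (fun x _ => by
      rw [Finset.mem_range, Nat.lt_succ_iff]
      simpa using hammingDist_le_card_fintype (x := v) (y := x))]
  refine Finset.sum_congr rfl fun t _ => ?_
  rw [distCount_eq_card_filter, Finset.sum_congr rfl fun x hx => by
    rw [(Finset.mem_filter.1 hx).2], Finset.sum_const, nsmul_eq_mul, mul_comm,
    Finset.filter_filter]
  simp only [SetLike.mem_coe]

/-- A three-dimensional MDS code of covering radius at most `n - 4` is not uniformly packed. -/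
theorem IsMDSCode.not_isUPWS_of_coveringRadius_add_four_le [Fintype F] (hD : IsMDSCode D 3 d)
    (hd : 0 < d) (hq : 4 < Fintype.card F)
    (hr : coveringRadius (D : Set (Fin n → F)) + 4 ≤ n) :
    ¬ IsUPWS (D : Set (Fin n → F)) := by
  classical
  unfold IsUPWS
  generalize coveringRadius (D : Set (Fin n → F)) = r at hr
  rintro ⟨b, hb⟩
  -- Extended by zero beyond r, so β vanishes at n - 3, ..., n because r ≤ n - 4.
  let β : ℕ → ℂ := fun t => if h : t < r + 1 then (b ⟨t, h⟩ : ℂ) else 0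
  have hβ : ∀ v, ∑ x with x ∈ D, β (hammingDist v x) = 1 := by
    intro v
    rw [sum_range_mul_distCount, ← Finset.sum_subset
      (Finset.range_subset_range.2 (show r + 1 ≤ n + 1 by omega)), Finset.sum_range]
    · have := congrArg (fun z : ℚ => (z : ℂ)) (hb v)
      push_cast at this
      rw [← this]
      refine Finset.sum_congr rfl fun t _ => ?_
      simp only [β, dif_pos t.2]
    · intro t _ ht
      simp only [β, dif_neg (fun h => ht (Finset.mem_range.2 h)), zero_mul]
  let Γ : ℂ[X] →ₗ[ℂ] ℂ := (basisMonomials ℂ).constr ℂ β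
  have hΓ : ∀ t, Γ (X ^ t) = β t := by
    intro t
    have := (basisMonomials ℂ).constr_basis ℂ β t
    simpa only [coe_basisMonomials, monomial_one_right_eq_X_pow] using this
  have hzero := map_one_sub_X_pow_mul_X_pow_eq_zero (n := n) (r := 4)
    ((Fintype.card F : ℂ) - 1) (by
      rw [add_sub_cancel, Nat.cast_ne_zero]
      omega) Γ (by
    intro w hw hwn
    obtain ⟨u, huw, hdual⟩ := hD.exists_dual_hammingNorm_eq hd hq w hw hwn
    have := map_krawtchouk_eq_zero D β Γ hΓ hβ u (by
      rintro rfl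
      rw [hammingNorm_zero] at huw
      omega) hdual
    rwa [huw] at this)
  have hrec : ∀ j, j + 4 ≤ n → β j = 4 * β (j + 1) - 6 * β (j + 2) + 4 * β (j + 3) - β (j + 4) := by
    intro j hj
    have h0 := hzero j 4 le_rfl (by omega)
    have key : ((1 - X) ^ 4 * X ^ j : ℂ[X]) = X ^ j - (4 : ℂ) • X ^ (j + 1) +
        (6 : ℂ) • X ^ (j + 2) - (4 : ℂ) • X ^ (j + 3) + X ^ (j + 4) := by
      simp only [smul_eq_C_mul, map_ofNat]
      ring
    rw [key] at h0
    simp only [map_add, map_sub, map_smul, hΓ, smul_eq_mul] at h0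
    linear_combination h0
  -- Descending induction from these four zeros, by the recurrence `hrec`.
  have hall : ∀ e j, n < j + 4 + e → β j = 0 := by
    intro e
    induction e with
    | zero =>
      intro j hj
      exact dif_neg (by omega)
    | succ e ih =>
      intro j hj
      by_cases hjn : j + 4 ≤ n
      · rw [hrec j hjn, ih (j + 1) (by omega), ih (j + 2) (by omega), ih (j + 3) (by omega),
          ih (j + 4) (by omega)]
        ring
      · exact ih j (by omega)
  have h1 := hβ 0
  rw [Finset.sum_eq_zero fun x _ => hall n _ (by omega)] at h1
  exact zero_ne_one h1

end DualWeights
end CodingTheory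

/-! ### The main theorem -/

theorem mainTheorem3 {F : Type*} [Field F] [Fintype F] [DecidableEq F]
    (m : ℕ) (hm : 1 < m) (hF : Fintype.card F = 2 ^ m)
    (C : Submodule F (Fin (2 ^ m + 2) → F)) :
    (Odd m → CodingTheory.IsMDSCode C 3 (2 ^ m) →
      ¬ CodingTheory.IsUPWS (C : Set (Fin (2 ^ m + 2) → F)) ∧
      ¬ CodingTheory.IsCompletelyRegular (C : Set (Fin (2 ^ m + 2) → F))) ∧
    (CodingTheory.IsMDSCode C (2 ^ m - 1) 4 →
      CodingTheory.IsCompletelyRegular (C : Set (Fin (2 ^ m + 2) → F))) := by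
  have hn : 2 ^ m + 2 = Fintype.card F + 2 := by rw [hF]
  refine ⟨fun hodd hC => ?_, fun hC => hC.isCompletelyRegular_of_distance_four hn⟩
  -- An odd m > 1 is at least 3, so q ≥ 8 meets both size conditions q > 6 and q > 4.
  have h8 : 2 ^ 3 ≤ 2 ^ m := by
    refine Nat.pow_le_pow_right (by norm_num) ?_
    obtain ⟨a, rfl⟩ := hodd
    omega
  have hmod : Fintype.card F % 3 = 2 := by
    obtain ⟨a, rfl⟩ := hodd
    rw [hF, pow_succ, pow_mul, Nat.mul_mod, Nat.pow_mod]
    norm_num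
  have hr : CodingTheory.coveringRadius (C : Set (Fin (2 ^ m + 2) → F)) + 4 ≤ 2 ^ m + 2 := by
    have : CodingTheory.coveringRadius (C : Set (Fin (2 ^ m + 2) → F)) ≤ 2 ^ m + 2 - 4 := by
      refine Finset.sup_le fun v _ => ?_
      have := hC.distToCode_add_four_le hn (by omega) hmod v
      omega
    omega
  have hU := hC.not_isUPWS_of_coveringRadius_add_four_le (by omega) (by omega) hr
  exact ⟨hU, fun hCR => hU (hCR.isUPWS ⟨0, C.zero_mem⟩)⟩
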